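/- Let $d\in\mathbb{N}$ and let $\Omega\subset\mathbb{C}^d$ be a domain (a non-empty connected open set, not necessarily bounded). Let $\mathsf{k}_\Omega$ be its Kobayashi pseudodistance, i.e. $\mathsf{k}_\Omega(z,w)$ is the infimum of $\sum_j \mathsf{k}_{\mathbb{D}}(\zeta_j,\xi_j)$ over finite chains of holomorphic maps $f_j:\mathbb{D}\to\Omega$ with points $\zeta_j,\xi_j\in\mathbb{D}$ such that the chain $f_1(\zeta_1)=z$, $f_j(\xi_j)=f_{j+1}(\zeta_{j+1})$ ends at $w$, where $\mathsf{k}_{\mathbb{D}}(\zeta,\xi)=\frac12\log\frac{1+\rho}{1-\rho}$ with $\rho=\left|\frac{\zeta-\xi}{1-\bar\xi\zeta}\right|$. Suppose that - $\Omega$ is complete Kobayashi hyperbolic, i.e. $\mathsf{k}_\Omega$ is a distance on $\Omega$ and $(\Omega,\mathsf{k}_\Omega)$ is Cauchy-complete; - $\Omega$ has the visibility property with respect to the geodesics of $\mathsf{k}_\Omega$, i.e. for any two distinct points $x,y\in\partial\Omega$ there are disjoint neighbourhoods $U_x,U_y$ of $x,y$ in $\mathbb{C}^d$ and a compact set $K\subset\Omega$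 such that every geodesic $\gamma:[a,b]\to\Omega$ (that is, $\mathsf{k}_\Omega(\gamma(s),\gamma(t))=|s-t|$ for all $s,t\in[a,b]$) with $\gamma(a)\in U_x$ and $\gamma(b)\in U_y$ meets $K$. For $o\in\Omega$, $x\in\partial\Omega$ and $R>0$ let $$H^b_o(x,R)=\Big\{z\in\Omega:\ \liminf_{w\to x,\ w\in\Omega}\big(\mathsf{k}_\Omega(z,w)-\mathsf{k}_\Omega(o,w)\big)<\tfrac12\log R\Big\}$$ be the big horosphere with centre $x$, pole $o$ and radius $R$. Then for all $o\in\Omega$, $x\in\partial\Omega$ and $R>0$, $$\overline{H^b_o(x,R)}\cap\partial\Omega=\{x\},$$ where closure and boundary are taken in $\mathbb{C}^d$. -/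

import Mathlib

open Filter Topology Metric

noncomputable section

namespace Kobayashi

/-- The Poincaré distance of the unit disc, normalised so that
`poincareDist 0 r = (1/2) * log ((1 + r) / (1 - r))` for `0 ≤ r < 1`. -/
def poincareDist (ζ ξ : ℂ) : ℝ :=
  (1 / 2) * Real.log
    ((1 + ‖(ζ - ξ) / (1 - (starRingEnd ℂ) ξ * ζ)‖) /
      (1 - ‖(ζ - ξ) / (1 - (starRingEnd ℂ) ξ * ζ)‖))

/-- `DiscChain Ω z w ℓ`: there is a finite chain of holomorphic discs in `Ω` that joins `z` to `w`
and has total length `ℓ`, the sum of the Poincaré distances between the marked points. -/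
inductive DiscChain {d : ℕ} (Ω : Set (EuclideanSpace ℂ (Fin d))) :
    EuclideanSpace ℂ (Fin d) → EuclideanSpace ℂ (Fin d) → ℝ → Prop
  | nil (z : EuclideanSpace ℂ (Fin d)) (hz : z ∈ Ω) : DiscChain Ω z z 0
  | cons (z z' w : EuclideanSpace ℂ (Fin d)) (ℓ : ℝ)
      (f : ℂ → EuclideanSpace ℂ (Fin d)) (ζ ξ : ℂ)
      (hf : DifferentiableOn ℂ f (ball 0 1)) (hfΩ : Set.MapsTo f (ball 0 1) Ω)
      (hζ : ζ ∈ ball (0 : ℂ) 1) (hξ : ξ ∈ ball (0 : ℂ) 1)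
      (hz : f ζ = z) (hz' : f ξ = z') (tail : DiscChain Ω z' w ℓ) :
      DiscChain Ω z w (poincareDist ζ ξ + ℓ)

/-- The Kobayashi pseudodistance of a domain `Ω ⊆ ℂᵈ`. The set of lengths is bounded below by `0`,
and it is non-empty for `z, w ∈ Ω` when `Ω` is open and connected. -/
def kobayashiDist {d : ℕ} (Ω : Set (EuclideanSpace ℂ (Fin d)))
    (z w : EuclideanSpace ℂ (Fin d)) : ℝ :=
  sInf {ℓ : ℝ | DiscChain Ω z w ℓ}

/-- `Ω` is Kobayashi hyperbolic: the Kobayashi pseudodistance separates points. -/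
def IsHyperbolic {d : ℕ} (Ω : Set (EuclideanSpace ℂ (Fin d))) : Prop :=
  ∀ z ∈ Ω, ∀ w ∈ Ω, kobayashiDist Ω z w = 0 → z = w

/-- `Ω` is complete Kobayashi hyperbolic: the Kobayashi pseudodistance is a distance, and every
Cauchy sequence for it converges in `Ω` for it. -/
def IsCompleteHyperbolic {d : ℕ} (Ω : Set (EuclideanSpace ℂ (Fin d))) : Prop :=
  IsHyperbolic Ω ∧
    ∀ u : ℕ → EuclideanSpace ℂ (Fin d), (∀ n, u n ∈ Ω) →
      (∀ ε > 0, ∃ N, ∀ m ≥ N, ∀ n ≥ N, kobayashiDist Ω (u m) (u n) < ε) →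
      ∃ p ∈ Ω, Tendsto (fun n => kobayashiDist Ω (u n) p) atTop (𝓝 0)

/-- `γ`, restricted to `[a, b]`, is a geodesic of the Kobayashi distance of `Ω`. -/
def IsGeodesicOn {d : ℕ} (Ω : Set (EuclideanSpace ℂ (Fin d)))
    (γ : ℝ → EuclideanSpace ℂ (Fin d)) (a b : ℝ) : Prop :=
  Set.MapsTo γ (Set.Icc a b) Ω ∧
    ∀ s ∈ Set.Icc a b, ∀ t ∈ Set.Icc a b, kobayashiDist Ω (γ s) (γ t) = |s - t|

/-- The visibility property with respect to the geodesics of the Kobayashi distance. -/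
def HasGeodesicVisibility {d : ℕ} (Ω : Set (EuclideanSpace ℂ (Fin d))) : Prop :=
  ∀ x ∈ frontier Ω, ∀ y ∈ frontier Ω, x ≠ y →
    ∃ U ∈ 𝓝 x, ∃ V ∈ 𝓝 y, Disjoint U V ∧
      ∃ K : Set (EuclideanSpace ℂ (Fin d)), IsCompact K ∧ K ⊆ Ω ∧
        ∀ (γ : ℝ → EuclideanSpace ℂ (Fin d)) (a b : ℝ), a ≤ b → IsGeodesicOn Ω γ a b →
          γ a ∈ U → γ b ∈ V → ∃ t ∈ Set.Icc a b, γ t ∈ K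

/-- The big horosphere with centre `x`, pole `o` and radius `R`. The lower limit is taken as
`w → x` within `Ω`, in the extended reals. -/
def bigHorosphere {d : ℕ} (Ω : Set (EuclideanSpace ℂ (Fin d)))
    (o x : EuclideanSpace ℂ (Fin d)) (R : ℝ) : Set (EuclideanSpace ℂ (Fin d)) :=
  {z | z ∈ Ω ∧
    liminf (fun w => ((kobayashiDist Ω z w - kobayashiDist Ω o w : ℝ) : EReal)) (𝓝[Ω] x) <
      (((1 / 2) * Real.log R : ℝ) : EReal)}

end Kobayashi

end

/-!
By Barth's theorem, the Kobayashi distance `k` of a hyperbolic domain `Ω` induces the Euclidean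
topology, and chains of discs make it a length metric. If it is complete, the Hopf–Rinow theorem
therefore turns `Ω` into a proper geodesic space.

If `y ≠ x` are boundary points, a geodesic from `z` near `y` to `w` near `x` meets a fixed compact
set, so that `k z w - k o w ≥ k o z - C`, which exceeds any bound as `z → y`: no horosphere at `x`
accumulates at `y`. Conversely, visibility keeps the geodesics from `o` to points `w → x` near `x`
from a uniform time on. A limit point `z` of their positions at a large time `t` lies in the
horosphere, because `k z w - k o w` is nearly `-t` for points `w` arbitrarily close to `x`.
-/

/-! ### Length spaces -/

section LengthSpace

variable {X : Type*} [MetricSpace X]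

/-- The curve `γ` is an isometric embedding of the interval `[a, b]`. -/
def IsGeodesicSegment (γ : ℝ → X) (a b : ℝ) : Prop :=
  ∀ s ∈ Set.Icc a b, ∀ t ∈ Set.Icc a b, dist (γ s) (γ t) = |s - t|

/-- Any two points are joined by a geodesic segment, parametrised by the distance to the first. -/
def IsGeodesicSpace (X : Type*) [MetricSpace X] : Prop :=
  ∀ x y : X, ∃ γ, IsGeodesicSegment γ 0 (dist x y) ∧ γ 0 = x ∧ γ (dist x y) = y

/-- Length spaces: the distance of two points is the infimum of the lengths of the curves that join
them. Curves are parametrised over `ℝ` with speed at most one, and the time `ℓ` that they take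
replaces their length. -/
def IsLengthSpace (X : Type*) [MetricSpace X] : Prop :=
  ∀ x y : X, ∀ r, dist x y < r → ∃ ℓ ∈ Set.Ico 0 r, ∃ c, LipschitzWith 1 c ∧ c 0 = x ∧ c ℓ = y

namespace IsGeodesicSegment

variable {γ : ℝ → X} {a b t : ℝ}

lemma dist_left (hγ : IsGeodesicSegment γ a b) (ht : t ∈ Set.Icc a b) :
    dist (γ a) (γ t) = t - a := by
  rw [hγ a ⟨le_rfl, ht.1.trans ht.2⟩ t ht, abs_sub_comm, abs_of_nonneg (sub_nonneg.2 ht.1)]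

lemma dist_right (hγ : IsGeodesicSegment γ a b) (ht : t ∈ Set.Icc a b) :
    dist (γ t) (γ b) = b - t := by
  rw [hγ t ht b ⟨ht.1.trans ht.2, le_rfl⟩, abs_sub_comm, abs_of_nonneg (sub_nonneg.2 ht.2)]

lemma mono (hγ : IsGeodesicSegment γ a b) {a' b' : ℝ} (ha : a ≤ a') (hb : b' ≤ b) :
    IsGeodesicSegment γ a' b' :=
  have hsub := Set.Icc_subset_Icc ha hb
  fun s hs t ht => hγ s (hsub hs) t (hsub ht)

lemma continuousOn (hγ : IsGeodesicSegment γ a b) : ContinuousOn γ (Set.Icc a b) :=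
  (LipschitzOnWith.of_dist_le_mul (K := 1) fun s hs t ht => by
    simp [hγ s hs t ht, Real.dist_eq]).continuousOn

lemma of_lipschitzWith (hγ : LipschitzWith 1 γ) (hab : dist (γ a) (γ b) = b - a) :
    IsGeodesicSegment γ a b := by
  have hle (s t : ℝ) : dist (γ s) (γ t) ≤ |s - t| := by
    simpa [Real.dist_eq] using hγ.dist_le_mul s t
  have hge : ∀ s ∈ Set.Icc a b, ∀ t ∈ Set.Icc a b, |s - t| ≤ dist (γ s) (γ t) := by
    intro s hs t ht
    wlog hst : s ≤ t generalizing s t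
    · simpa [abs_sub_comm, dist_comm] using this t ht s hs (le_of_not_ge hst)
    have has := hle a s
    have htb := hle t b
    rw [abs_sub_comm, abs_of_nonneg (by linarith [hs.1])] at has
    rw [abs_sub_comm, abs_of_nonneg (by linarith [ht.2])] at htb
    rw [abs_sub_comm, abs_of_nonneg (by linarith)]
    linarith [dist_triangle4 (γ a) (γ s) (γ t) (γ b)]
  exact fun s hs t ht => (hle s t).antisymm (hge s hs t ht)

end IsGeodesicSegment

lemma isCompact_setOf_lipschitzWith_apply_eq {α Y : Type*} [PseudoMetricSpace α] [MetricSpace Y]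
    [ProperSpace Y] (K : NNReal) (a : α) (y : Y) :
    IsCompact {f : α → Y | LipschitzWith K f ∧ f a = y} := by
  refine (isCompact_univ_pi fun t : α => isCompact_closedBall y (K * dist t a)).of_isClosed_subset
    ((isClosed_setOfPred_lipschitzWith K).inter
      (isClosed_eq (continuous_apply a) continuous_const)) ?_
  rintro f ⟨hf, rfl⟩ t -
  exact hf.dist_le_mul t a

namespace IsLengthSpace

lemma exists_dist_le_dist_lt (hX : IsLengthSpace X) {x y : X} {r s : ℝ} (hr : 0 ≤ r) (hs : 0 < s)
    (hxy : dist x y < r + s) : ∃ z ∈ closedBall x r, dist y z < s := by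
  obtain ⟨ℓ, ⟨hℓ0, hℓ⟩, c, hc, rfl, rfl⟩ := hX x y _ hxy
  have hle (a b : ℝ) : dist (c a) (c b) ≤ |a - b| := by
    simpa [Real.dist_eq] using hc.dist_le_mul a b
  rcases le_total r ℓ with hrl | hrl
  · refine ⟨c r, (hle r 0).trans (by simp [abs_of_nonneg hr]), (hle ℓ r).trans_lt ?_⟩
    rw [abs_of_nonneg (sub_nonneg.2 hrl)]
    linarith
  · exact ⟨c ℓ, (hle ℓ 0).trans (by simpa [abs_of_nonneg hℓ0]), by simpa⟩

lemma isCompact_closedBall_of_forall_lt [CompleteSpace X] (hX : IsLengthSpace X) {x : X} {r : ℝ}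
    (h : ∀ r' < r, IsCompact (closedBall x r')) : IsCompact (closedBall x r) := by
  rcases le_or_gt r 0 with hr | hr
  · exact (subsingleton_closedBall x hr).isCompact
  refine isCompact_iff_totallyBounded_isComplete.2 ⟨?_, isClosed_closedBall.isComplete⟩
  refine Metric.totallyBounded_iff.2 fun ε hε => ?_
  obtain ⟨r', hr'0, hr'r, hr'ε⟩ : ∃ r', 0 ≤ r' ∧ r' < r ∧ r < r' + ε / 2 :=
    ⟨max 0 (r - ε / 4), le_max_left _ _, max_lt hr (by linarith),
      by linarith [le_max_right 0 (r - ε / 4)]⟩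
  obtain ⟨t, ht, hcover⟩ := Metric.totallyBounded_iff.1 (h r' hr'r).totallyBounded _ (half_pos hε)
  refine ⟨t, ht, fun y hy => ?_⟩
  obtain ⟨z, hzx, hyz⟩ := hX.exists_dist_le_dist_lt hr'0 (half_pos hε)
    ((mem_closedBall'.1 hy).trans_lt hr'ε)
  obtain ⟨i, hi, hzi⟩ := Set.mem_iUnion₂.1 (hcover hzx)
  refine Set.mem_iUnion₂.2 ⟨i, hi, (dist_triangle y z i).trans_lt ?_⟩
  linarith [mem_ball.1 hzi]

lemma exists_isCompact_closedBall_add [LocallyCompactSpace X] (hX : IsLengthSpace X) {x : X}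
    {r : ℝ} (hr : 0 ≤ r) (h : IsCompact (closedBall x r)) :
    ∃ δ > 0, IsCompact (closedBall x (r + δ)) := by
  obtain ⟨K, hK, hsub⟩ := exists_compact_superset h
  obtain ⟨δ, hδ, hthick⟩ := h.exists_thickening_subset_open isOpen_interior hsub
  refine ⟨δ / 2, half_pos hδ, hK.of_isClosed_subset isClosed_closedBall fun y hy => ?_⟩
  obtain ⟨z, hzx, hyz⟩ := hX.exists_dist_le_dist_lt hr hδ
    ((mem_closedBall'.1 hy).trans_lt (by linarith))
  exact interior_subset (hthick (mem_thickening_iff.2 ⟨z, hzx, hyz⟩))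

/-- **Hopf–Rinow–Cohn-Vossen theorem**, first part. -/
theorem properSpace [CompleteSpace X] [LocallyCompactSpace X] (hX : IsLengthSpace X) :
    ProperSpace X := by
  refine ⟨fun x r₀ => ?_⟩
  by_contra hr₀
  let S := {r | ¬IsCompact (closedBall x r)}
  have hpos : ∀ r ∈ S, 0 ≤ r := fun r hr => by
    by_contra! hneg
    exact hr (subsingleton_closedBall x hneg.le).isCompact
  have hinf : IsCompact (closedBall x (sInf S)) :=
    hX.isCompact_closedBall_of_forall_lt fun r hr => not_not.1 (notMem_of_lt_csInf hr ⟨0, hpos⟩)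
  obtain ⟨δ, hδ, hcompact⟩ := hX.exists_isCompact_closedBall_add (le_csInf ⟨r₀, hr₀⟩ hpos) hinf
  obtain ⟨r, hr, hrδ⟩ := exists_lt_of_csInf_lt (s := S) ⟨r₀, hr₀⟩ (lt_add_of_pos_right _ hδ)
  exact hr (hcompact.of_isClosed_subset isClosed_closedBall (closedBall_subset_closedBall hrδ.le))

/-- **Hopf–Rinow–Cohn-Vossen theorem**, second part. -/
theorem isGeodesicSpace [ProperSpace X] (hX : IsLengthSpace X) : IsGeodesicSpace X := by
  intro x y
  -- Among the curves of speed at most one from `x`, a geodesic is one that, at time `dist x y`,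
  -- comes closest to `y`.
  have hnear : ∀ ε > 0, ∃ c : ℝ → X, (LipschitzWith 1 c ∧ c 0 = x) ∧ dist (c (dist x y)) y < ε := by
    intro ε hε
    obtain ⟨ℓ, ⟨hℓ0, hℓ⟩, c, hc, rfl, rfl⟩ := hX x y _ (lt_add_of_pos_right _ hε)
    have hle (a b : ℝ) : dist (c a) (c b) ≤ |a - b| := by
      simpa [Real.dist_eq] using hc.dist_le_mul a b
    have hdist : dist (c 0) (c ℓ) ≤ ℓ := by simpa [abs_of_nonneg hℓ0] using hle 0 ℓ
    refine ⟨c, ⟨hc, rfl⟩, (hle _ ℓ).trans_lt ?_⟩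
    rw [abs_sub_comm, abs_of_nonneg (sub_nonneg.2 hdist)]
    linarith
  obtain ⟨γ, ⟨hγ, hγ0⟩, hmin⟩ := (isCompact_setOf_lipschitzWith_apply_eq 1 (0 : ℝ) x).exists_isMinOn
    ((hnear 1 one_pos).imp fun _ h => h.1)
    (f := fun c => dist (c (dist x y)) y) (by fun_prop)
  have hγL : γ (dist x y) = y := by
    refine dist_le_zero.1 (le_of_forall_gt fun ε hε => ?_)
    obtain ⟨c, hc, hcε⟩ := hnear ε hε
    exact (hmin hc).trans_lt hcε
  exact ⟨γ, .of_lipschitzWith hγ (by rw [hγ0, hγL, sub_zero]), hγ0, hγL⟩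

end IsLengthSpace

end LengthSpace

/-! ### Visibility and horospheres -/

section Visibility

lemma exists_mem_Icc_mem_frontier {Y : Type*} [TopologicalSpace Y] {c : ℝ → Y} {a b : ℝ}
    {N : Set Y} (hab : a ≤ b) (hc : ContinuousOn c (Set.Icc a b)) (ha : c a ∈ N) (hb : c b ∉ N) :
    ∃ t ∈ Set.Icc a b, c t ∈ frontier N := by
  by_contra! hN
  have hclosure : ∀ t ∈ Set.Icc a b, c t ∈ closure N → c t ∈ interior N := fun t ht hmem => by
    by_contra hint
    exact hN t ht ⟨hmem, hint⟩
  have hsub := (isPreconnected_Icc.image c hc).subset_of_closure_inter_subset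
    isOpen_interior ⟨c a, ⟨a, ⟨le_rfl, hab⟩, rfl⟩,
      hclosure a ⟨le_rfl, hab⟩ (subset_closure ha)⟩ ?_
  · exact hb (interior_subset (hsub ⟨b, ⟨hab, le_rfl⟩, rfl⟩))
  · rintro _ ⟨hmem, t, ht, rfl⟩
    exact hclosure t ht (closure_mono interior_subset hmem)

variable {X Y : Type*} [MetricSpace X] {ι : X → Y}

/-- The big horosphere with pole `o` and radius `exp (2 * c)`, with its centre given by the filter
`l` of neighbourhoods of an ideal point. -/
def horosphereAlong (o : X) (l : Filter X) (c : ℝ) : Set X :=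
  {z | liminf (fun w => ((dist z w - dist o w : ℝ) : EReal)) l < (c : EReal)}

/-- On the geodesics from `o` that end in `V`, the set `U` is only met up to time `T`. -/
def VisitsUpTo (ι : X → Y) (o : X) (U V : Set Y) (T : ℝ) : Prop :=
  ∀ (γ : ℝ → X) (L : ℝ), IsGeodesicSegment γ 0 L → γ 0 = o → ι (γ L) ∈ V →
    ∀ s ∈ Set.Icc 0 L, ι (γ s) ∈ U → s ≤ T

lemma VisitsUpTo.mono {o : X} {U U' V V' : Set Y} {T T' : ℝ} (h : VisitsUpTo ι o U V T)
    (hU : U' ⊆ U) (hV : V' ⊆ V) (hT : T ≤ T') : VisitsUpTo ι o U' V' T' :=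
  fun γ L hγ h0 hL s hs hsU => (h γ L hγ h0 (hV hL) s hs (hU hsU)).trans hT

lemma VisitsUpTo.union {o : X} {U U' V V' : Set Y} {T T' : ℝ} (h : VisitsUpTo ι o U V T)
    (h' : VisitsUpTo ι o U' V' T') : VisitsUpTo ι o (U ∪ U') (V ∩ V') (max T T') :=
  fun γ L hγ h0 hL s hs hsU => hsU.elim
    (fun hsU => (h γ L hγ h0 hL.1 s hs hsU).trans (le_max_left T T'))
    (fun hsU => (h' γ L hγ h0 hL.2 s hs hsU).trans (le_max_right T T'))

variable [TopologicalSpace Y]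

/-- The visibility property of an embedding `ι`: geodesics that join points near two distinct
boundary points of its range meet a compact set. -/
def HasVisibility (ι : X → Y) : Prop :=
  ∀ x ∈ frontier (Set.range ι), ∀ y ∈ frontier (Set.range ι), x ≠ y →
    ∃ U ∈ 𝓝 x, ∃ V ∈ 𝓝 y, ∃ K : Set X, IsCompact K ∧
      ∀ (γ : ℝ → X) (a b : ℝ), a ≤ b → IsGeodesicSegment γ a b →
        ι (γ a) ∈ U → ι (γ b) ∈ V → ∃ t ∈ Set.Icc a b, γ t ∈ K

lemma HasVisibility.exists_visitsUpTo_nhds_of_ne (hvis : HasVisibility ι)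
    (hι : IsOpenEmbedding ι) (o : X) {x y : Y} (hx : x ∈ frontier (Set.range ι)) (hyx : y ≠ x) :
    ∃ U ∈ 𝓝 y, ∃ V ∈ 𝓝 x, ∃ T, VisitsUpTo ι o U V T := by
  by_cases hyX : y ∈ Set.range ι
  · obtain ⟨p, rfl⟩ := hyX
    refine ⟨ι '' ball p 1, hι.isOpenMap.image_mem_nhds (ball_mem_nhds p one_pos), Set.univ,
      univ_mem, dist o p + 1, ?_⟩
    rintro γ L hγ rfl - s hs ⟨q, hq, hqs⟩
    rw [hι.injective hqs, mem_ball'] at hq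
    linarith [hγ.dist_left hs, dist_triangle (γ 0) p (γ s)]
  by_cases hycl : y ∈ closure (Set.range ι)
  · have hy : y ∈ frontier (Set.range ι) := by
      rw [hι.isOpen_range.frontier_eq]
      exact ⟨hycl, hyX⟩
    obtain ⟨U, hU, V, hV, K, hK, hmeet⟩ := hvis y hy x hx hyx
    obtain ⟨T, hT⟩ := hK.isBounded.subset_closedBall o
    refine ⟨U, hU, V, hV, T, ?_⟩
    rintro γ L hγ rfl hL s hs hsU
    obtain ⟨t, ht, htK⟩ := hmeet γ s L hs.2 (hγ.mono hs.1 le_rfl) hsU hL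
    linarith [hγ.dist_left ⟨hs.1.trans ht.1, ht.2⟩, mem_closedBall'.1 (hT htK), ht.1]
  · exact ⟨_, isClosed_closure.isOpen_compl.mem_nhds hycl, Set.univ, univ_mem, 0,
      fun γ L _ _ _ s _ hs => absurd (subset_closure (Set.mem_range_self (γ s))) hs⟩

lemma HasVisibility.exists_visitsUpTo_of_isCompact (hvis : HasVisibility ι)
    (hι : IsOpenEmbedding ι) (o : X) {x : Y} (hx : x ∈ frontier (Set.range ι)) {S : Set Y}
    (hS : IsCompact S) (hxS : x ∉ S) :
    ∃ V ∈ 𝓝 x, ∃ T, VisitsUpTo ι o S V T := by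
  refine hS.induction_on (p := fun S => ∃ V ∈ 𝓝 x, ∃ T, VisitsUpTo ι o S V T) ?_ ?_ ?_ ?_
  · exact ⟨Set.univ, univ_mem, 0, fun _ _ _ _ _ _ _ hs => absurd hs (Set.notMem_empty _)⟩
  · exact fun S S' hSS' ⟨V, hV, T, h⟩ => ⟨V, hV, T, h.mono hSS' subset_rfl le_rfl⟩
  · exact fun S S' ⟨V, hV, T, h⟩ ⟨V', hV', T', h'⟩ =>
      ⟨V ∩ V', inter_mem hV hV', max T T', h.union h'⟩
  · intro y hy
    obtain ⟨U, hU, h⟩ := hvis.exists_visitsUpTo_nhds_of_ne hι o hx (ne_of_mem_of_not_mem hy hxS)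
    exact ⟨U, mem_nhdsWithin_of_mem_nhds hU, h⟩

/-- Geodesics from `o` that end near the boundary point `x` are near `x` from a uniform time on. -/
lemma HasVisibility.exists_visitsUpTo_compl [T2Space Y] [LocallyCompactSpace Y]
    (hvis : HasVisibility ι) (hι : IsOpenEmbedding ι) (o : X) {x : Y}
    (hx : x ∈ frontier (Set.range ι)) {N : Set Y} (hN : N ∈ 𝓝 x) :
    ∃ V ∈ 𝓝 x, ∃ T, VisitsUpTo ι o Nᶜ V T := by
  obtain ⟨K, hKx, hKN, hK⟩ := local_compact_nhds hN
  obtain ⟨V, hV, T, hT⟩ := hvis.exists_visitsUpTo_of_isCompact hι o hx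
    (hK.of_isClosed_subset isClosed_frontier hK.isClosed.frontier_subset)
    fun hfr => hfr.2 (mem_interior_iff_mem_nhds.2 hKx)
  refine ⟨V ∩ K, inter_mem hV hKx, T, fun γ L hγ h0 hL s hs hsN => ?_⟩
  have hcont : ContinuousOn (ι ∘ γ) (Set.Icc s L) :=
    hι.continuous.comp_continuousOn (hγ.mono hs.1 le_rfl).continuousOn
  obtain ⟨t, ht, htK⟩ := exists_mem_Icc_mem_frontier hs.2 hcont (N := Kᶜ)
    (fun hsK => hsN (hKN hsK)) (fun hLK => hLK hL.2)
  rw [frontier_compl] at htK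
  exact ht.1.trans (hT γ L hγ h0 hL.1 t ⟨hs.1.trans ht.1, ht.2⟩ htK)

lemma tendsto_dist_comap_nhds_atTop [ProperSpace X] [T2Space Y] (hι : Continuous ι) (o : X) {x : Y}
    (hx : x ∉ Set.range ι) : Tendsto (dist o) (comap ι (𝓝 x)) atTop := by
  refine (tendsto_dist_left_cocompact_atTop o).mono_left ?_
  refine hasBasis_cocompact.ge_iff.2 fun K hK => ?_
  refine ⟨(ι '' K)ᶜ, (hK.image hι).isClosed.isOpen_compl.mem_nhds fun hxK => ?_, ?_⟩
  · exact hx (Set.image_subset_range ι K hxK)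
  · exact fun p hp hpK => hp ⟨p, hpK, rfl⟩

lemma eq_of_mem_closure_image_horosphereAlong [ProperSpace X] [T2Space Y] (hX : IsGeodesicSpace X)
    (hι : IsOpenEmbedding ι) (hvis : HasVisibility ι) {o : X} {x y : Y} {c : ℝ}
    (hx : x ∈ frontier (Set.range ι)) (hy : y ∈ frontier (Set.range ι))
    (hyH : y ∈ closure (ι '' horosphereAlong o (comap ι (𝓝 x)) c)) : y = x := by
  by_contra hyx
  obtain ⟨U, hU, V, hV, K, hK, hmeet⟩ := hvis y hy x hx hyx
  obtain ⟨C, hC⟩ := hK.isBounded.subset_closedBall o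
  have hyX : y ∉ Set.range ι := (hι.isOpen_range.frontier_eq ▸ hy).2
  have hfar := eventually_comap.1
    ((tendsto_dist_comap_nhds_atTop hι.continuous o hyX).eventually_gt_atTop (c + 2 * C))
  obtain ⟨_, ⟨z, hzH, rfl⟩, hoz, hzU⟩ :=
    ((mem_closure_iff_frequently.1 hyH).and_eventually (hfar.and hU)).exists
  obtain ⟨w, hwc, hwV⟩ := ((frequently_lt_of_liminf_lt (by isBoundedDefault)
    (Set.mem_ofPred.1 hzH)).and_eventually
    (preimage_mem_comap hV)).exists
  rw [EReal.coe_lt_coe_iff] at hwc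
  obtain ⟨γ, hγ, rfl, hγw⟩ := hX z w
  obtain ⟨t, ht, htK⟩ := hmeet γ 0 _ dist_nonneg hγ hzU (by rwa [hγw])
  have hzt := hγ.dist_left ht
  have htw := hγ.dist_right ht
  rw [hγw] at htw
  have hot : dist o (γ t) ≤ C := mem_closedBall'.1 (hC htK)
  linarith [hoz _ rfl, dist_triangle_right o (γ 0) (γ t), dist_triangle o (γ t) w]

lemma HasVisibility.exists_forall_gt_eventually_exists_dist_eq [ProperSpace X] [T2Space Y]
    [LocallyCompactSpace Y] (hvis : HasVisibility ι) (hX : IsGeodesicSpace X)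
    (hι : IsOpenEmbedding ι) (o : X) {x : Y} (hx : x ∈ frontier (Set.range ι)) {N : Set Y}
    (hN : N ∈ 𝓝 x) : ∃ T, ∀ t > T, ∀ᶠ w in comap ι (𝓝 x),
      ∃ g, (g ∈ closedBall o t ∩ ι ⁻¹' N) ∧ dist g w = dist o w - t := by
  obtain ⟨V, hV, T, hT⟩ := hvis.exists_visitsUpTo_compl hι o hx hN
  have hxX : x ∉ Set.range ι := (hι.isOpen_range.frontier_eq ▸ hx).2
  refine ⟨max 0 T, fun t ht => ?_⟩
  filter_upwards [(tendsto_dist_comap_nhds_atTop hι.continuous o hxX).eventually_ge_atTop t,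
    preimage_mem_comap hV] with w hwt hwV
  obtain ⟨γ, hγ, h0, hγw⟩ := hX o w
  have htL : t ∈ Set.Icc 0 (dist o w) := ⟨(le_max_left 0 T).trans ht.le, hwt⟩
  have hot := hγ.dist_left htL
  have htw := hγ.dist_right htL
  rw [h0, sub_zero] at hot
  rw [hγw] at htw
  refine ⟨γ t, ⟨mem_closedBall'.2 hot.le, ?_⟩, htw⟩
  by_contra htN
  exact ((le_max_right 0 T).trans_lt ht).not_ge (hT γ _ hγ h0 (by rwa [hγw]) t htL htN)

lemma mem_closure_image_horosphereAlong [ProperSpace X] [T2Space Y] [LocallyCompactSpace Y]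
    (hX : IsGeodesicSpace X) (hι : IsOpenEmbedding ι) (hvis : HasVisibility ι) (o : X) {x : Y}
    (c : ℝ) (hx : x ∈ frontier (Set.range ι)) :
    x ∈ closure (ι '' horosphereAlong o (comap ι (𝓝 x)) c) := by
  refine mem_closure_iff_nhds.2 fun N hN => ?_
  obtain ⟨K, hKx, hKN, hK⟩ := local_compact_nhds hN
  obtain ⟨T, hT⟩ := hvis.exists_forall_gt_eventually_exists_dist_eq hX hι o hx hKx
  obtain ⟨t, hTt, hct⟩ : ∃ t, T < t ∧ 1 - c ≤ t := ⟨max (T + 1) (1 - c), by simp, by simp⟩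
  have : NeBot (comap ι (𝓝 x)) := comap_neBot_iff_frequently.2
    (mem_closure_iff_frequently.1 (frontier_subset_closure hx))
  obtain ⟨g, hg⟩ := (hT t hTt).choice
  obtain ⟨z, ⟨-, hzK⟩, hz⟩ := ((isCompact_closedBall o t).inter_right
    (hK.isClosed.preimage hι.continuous)).exists_mapClusterPt_of_frequently
    (hg.mono fun _ h => h.1).frequently
  have hfreq : ∃ᶠ w in comap ι (𝓝 x), dist z w - dist o w ≤ 1 / 2 - t := by
    refine ((hz.frequently (ball_mem_nhds z one_half_pos)).and_eventually hg).mono ?_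
    rintro w ⟨hgz, -, hgw⟩
    linarith [dist_triangle_left z w (g w), mem_ball.1 hgz]
  refine ⟨ι z, hKN hzK, z, ?_, rfl⟩
  exact (liminf_le_of_frequently_le' (hfreq.mono fun _ h => EReal.coe_le_coe_iff.2 h)).trans_lt
    (EReal.coe_lt_coe_iff.2 (by linarith))

theorem closure_image_horosphereAlong_inter_frontier [ProperSpace X] [T2Space Y]
    [LocallyCompactSpace Y] (hX : IsGeodesicSpace X) (hι : IsOpenEmbedding ι)
    (hvis : HasVisibility ι) (o : X) {x : Y} (hx : x ∈ frontier (Set.range ι)) (c : ℝ) :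
    closure (ι '' horosphereAlong o (comap ι (𝓝 x)) c) ∩ frontier (Set.range ι) = {x} :=
  Set.Subset.antisymm
    (fun _ ⟨hyH, hy⟩ => eq_of_mem_closure_image_horosphereAlong hX hι hvis hx hy hyH)
    (Set.singleton_subset_iff.2 ⟨mem_closure_image_horosphereAlong hX hι hvis o c hx, hx⟩)

end Visibility

namespace Kobayashi

/-! ### The Poincaré distance of the unit disc -/

section Disc

variable {ζ ξ a : ℂ}

lemma norm_add_lt_norm_one_add_conj_mul (hζ : ζ ∈ ball (0 : ℂ) 1) (ha : a ∈ ball (0 : ℂ) 1) :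
    ‖a + ζ‖ < ‖1 + (starRingEnd ℂ) ζ * a‖ := by
  have hidentity : ‖1 + (starRingEnd ℂ) ζ * a‖ ^ 2 - ‖a + ζ‖ ^ 2 =
      (1 - ‖a‖ ^ 2) * (1 - ‖ζ‖ ^ 2) := by
    simp only [← Complex.normSq_eq_norm_sq, Complex.normSq_apply, Complex.add_re, Complex.add_im,
      Complex.mul_re, Complex.mul_im, Complex.conj_re, Complex.conj_im, Complex.one_re,
      Complex.one_im]
    ring
  have hsq {b : ℂ} (hb : b ∈ ball (0 : ℂ) 1) : 0 < 1 - ‖b‖ ^ 2 :=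
    sub_pos.2 (pow_lt_one₀ (norm_nonneg b) (mem_ball_zero_iff.1 hb) two_ne_zero)
  exact lt_of_pow_lt_pow_left₀ 2 (norm_nonneg _) (by linarith [mul_pos (hsq ha) (hsq hζ)])

lemma one_add_conj_mul_ne_zero (hζ : ζ ∈ ball (0 : ℂ) 1) (ha : a ∈ ball (0 : ℂ) 1) :
    1 + (starRingEnd ℂ) ζ * a ≠ 0 :=
  norm_pos_iff.1 ((norm_nonneg _).trans_lt (norm_add_lt_norm_one_add_conj_mul hζ ha))

/-- The automorphism of the unit disc that sends `0` to `ζ` and `-ζ` to `0`. -/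
noncomputable def discShift (ζ a : ℂ) : ℂ := (a + ζ) / (1 + (starRingEnd ℂ) ζ * a)

lemma discShift_mem_ball (hζ : ζ ∈ ball (0 : ℂ) 1) (ha : a ∈ ball (0 : ℂ) 1) :
    discShift ζ a ∈ ball (0 : ℂ) 1 := by
  have h := norm_add_lt_norm_one_add_conj_mul hζ ha
  rwa [mem_ball_zero_iff, discShift, norm_div, div_lt_one ((norm_nonneg _).trans_lt h)]

lemma differentiableOn_discShift (hζ : ζ ∈ ball (0 : ℂ) 1) :
    DifferentiableOn ℂ (discShift ζ) (ball 0 1) :=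
  DifferentiableOn.div (by fun_prop) (by fun_prop) fun _ ha => one_add_conj_mul_ne_zero hζ ha

lemma discShift_discShift_neg (hζ : ζ ∈ ball (0 : ℂ) 1) (hξ : ξ ∈ ball (0 : ℂ) 1) :
    discShift ζ (discShift (-ζ) ξ) = ξ := by
  have hζ' : -ζ ∈ ball (0 : ℂ) 1 := by simpa using hζ
  have h₁ := one_add_conj_mul_ne_zero hζ' hξ
  have h₂ := one_add_conj_mul_ne_zero hζ (discShift_mem_ball hζ' hξ)
  simp only [discShift, map_neg, neg_mul, ← sub_eq_add_neg] at h₁ h₂ ⊢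
  rw [div_eq_iff h₂]
  linear_combination div_mul_cancel₀ (ξ - ζ) h₁

lemma poincareDist_comm (ζ ξ : ℂ) : poincareDist ζ ξ = poincareDist ξ ζ := by
  have h : ‖(ζ - ξ) / (1 - (starRingEnd ℂ) ξ * ζ)‖ = ‖(ξ - ζ) / (1 - (starRingEnd ℂ) ζ * ξ)‖ := by
    rw [norm_div, norm_div, norm_sub_rev, ← Complex.norm_conj (1 - (starRingEnd ℂ) ξ * ζ)]
    simp [mul_comm]
  simp only [poincareDist, h]

lemma poincareDist_eq_artanh (hζ : ζ ∈ ball (0 : ℂ) 1) (hξ : ξ ∈ ball (0 : ℂ) 1) :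
    poincareDist ζ ξ = Real.artanh ‖discShift (-ζ) ξ‖ := by
  have h := mem_ball_zero_iff.1 (discShift_mem_ball (by simpa using hζ : -ζ ∈ ball (0 : ℂ) 1) hξ)
  rw [Real.artanh_eq_half_log ⟨by linarith [norm_nonneg (discShift (-ζ) ξ)], h.le⟩,
    poincareDist_comm]
  simp [poincareDist, discShift, sub_eq_add_neg]

lemma poincareDist_nonneg (hζ : ζ ∈ ball (0 : ℂ) 1) (hξ : ξ ∈ ball (0 : ℂ) 1) :
    0 ≤ poincareDist ζ ξ := by
  rw [poincareDist_eq_artanh hζ hξ]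
  exact Real.artanh_nonneg (norm_nonneg _)

lemma tanh_sub (s t : ℝ) :
    Real.tanh (s - t) = (Real.tanh s - Real.tanh t) / (1 - Real.tanh t * Real.tanh s) := by
  have hs := (Real.cosh_pos s).ne'
  have ht := (Real.cosh_pos t).ne'
  have hst := (Real.cosh_pos (s - t)).ne'
  rw [Real.cosh_sub] at hst
  have hdenom : 1 - Real.sinh t / Real.cosh t * (Real.sinh s / Real.cosh s) =
      (Real.cosh s * Real.cosh t - Real.sinh s * Real.sinh t) / (Real.cosh s * Real.cosh t) := by
    field_simp
  simp only [Real.tanh_eq_sinh_div_cosh, hdenom, Real.sinh_sub, Real.cosh_sub]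
  field_simp

lemma abs_tanh (t : ℝ) : |Real.tanh t| = Real.tanh |t| := by
  rw [Real.tanh_eq_sinh_div_cosh, Real.tanh_eq_sinh_div_cosh, abs_div, Real.abs_sinh,
    Real.cosh_abs, abs_of_pos (Real.cosh_pos t)]

lemma tanh_pos {t : ℝ} (ht : 0 < t) : 0 < Real.tanh t := by
  rw [Real.tanh_eq_sinh_div_cosh]
  exact div_pos (Real.sinh_pos_iff.2 ht) (Real.cosh_pos t)

lemma continuous_tanh : Continuous Real.tanh := by
  simp only [funext Real.tanh_eq_sinh_div_cosh]
  exact Real.continuous_sinh.div Real.continuous_cosh fun t => (Real.cosh_pos t).ne'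

lemma ofReal_tanh_mem_ball (t : ℝ) : (Real.tanh t : ℂ) ∈ ball (0 : ℂ) 1 := by
  rw [mem_ball_zero_iff, Complex.norm_real]
  exact Real.abs_tanh_lt_one t

lemma poincareDist_tanh (s t : ℝ) : poincareDist (Real.tanh s) (Real.tanh t) = |s - t| := by
  have hshift : discShift (-(Real.tanh s : ℂ)) (Real.tanh t) = (Real.tanh (t - s) : ℝ) := by
    rw [tanh_sub]
    simp only [discShift, map_neg, Complex.conj_ofReal]
    push_cast
    ring
  rw [poincareDist_eq_artanh (ofReal_tanh_mem_ball s) (ofReal_tanh_mem_ball t), hshift,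
    Complex.norm_real, Real.norm_eq_abs, abs_tanh, Real.artanh_tanh, abs_sub_comm]

lemma exists_disc_automorphism_tanh (hζ : ζ ∈ ball (0 : ℂ) 1) (hξ : ξ ∈ ball (0 : ℂ) 1) :
    ∃ φ : ℂ → ℂ, DifferentiableOn ℂ φ (ball 0 1) ∧ Set.MapsTo φ (ball 0 1) (ball 0 1) ∧
      φ (Real.tanh 0) = ζ ∧ φ (Real.tanh (poincareDist ζ ξ)) = ξ := by
  have hζ' : -ζ ∈ ball (0 : ℂ) 1 := by simpa using hζ
  obtain ⟨u, hu, hrot⟩ := Complex.exists_norm_mul_eq_self (discShift (-ζ) ξ)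
  have hmaps : Set.MapsTo (fun a => u * a) (ball 0 1) (ball 0 1) := fun a ha => by
    simpa [hu] using ha
  refine ⟨fun a => discShift ζ (u * a), (differentiableOn_discShift hζ).comp (by fun_prop) hmaps,
    fun a ha => discShift_mem_ball hζ (hmaps ha), by simp [discShift], ?_⟩
  have htanh : Real.tanh (poincareDist ζ ξ) = ‖discShift (-ζ) ξ‖ := by
    rw [poincareDist_eq_artanh hζ hξ, Real.tanh_artanh]
    exact ⟨by linarith [norm_nonneg (discShift (-ζ) ξ)],
      mem_ball_zero_iff.1 (discShift_mem_ball hζ' hξ)⟩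
  simp only [htanh, hrot]
  exact discShift_discShift_neg hζ hξ

end Disc

/-! ### Chains of discs and the Kobayashi pseudodistance -/

variable {d : ℕ} {Ω : Set (EuclideanSpace ℂ (Fin d))} {z w p : EuclideanSpace ℂ (Fin d)} {ℓ ℓ' : ℝ}

namespace DiscChain

lemma nonneg (h : DiscChain Ω z w ℓ) : 0 ≤ ℓ := by
  induction h with
  | nil => exact le_rfl
  | cons _ _ _ _ _ _ _ _ _ hζ hξ _ _ _ ih => exact add_nonneg (poincareDist_nonneg hζ hξ) ih

lemma trans (h : DiscChain Ω z w ℓ) (h' : DiscChain Ω w p ℓ') : DiscChain Ω z p (ℓ + ℓ') := by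
  induction h with
  | nil => simpa using h'
  | cons z z' _ _ f ζ ξ hf hfΩ hζ hξ hz hz' _ ih =>
    rw [add_assoc]
    exact .cons z z' p _ f ζ ξ hf hfΩ hζ hξ hz hz' (ih h')

lemma single {f : ℂ → EuclideanSpace ℂ (Fin d)} (hf : DifferentiableOn ℂ f (ball 0 1))
    (hfΩ : Set.MapsTo f (ball 0 1) Ω) {ζ ξ : ℂ} (hζ : ζ ∈ ball (0 : ℂ) 1)
    (hξ : ξ ∈ ball (0 : ℂ) 1) : DiscChain Ω (f ζ) (f ξ) (poincareDist ζ ξ) := by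
  simpa using DiscChain.cons (f ζ) (f ξ) (f ξ) 0 f ζ ξ hf hfΩ hζ hξ rfl rfl (.nil _ (hfΩ hξ))

lemma symm (h : DiscChain Ω z w ℓ) : DiscChain Ω w z ℓ := by
  induction h with
  | nil z hz => exact .nil z hz
  | cons _ _ _ _ _ _ _ hf hfΩ hζ hξ hz hz' _ ih =>
    subst hz hz'
    rw [add_comm, poincareDist_comm]
    exact ih.trans (.single hf hfΩ hξ hζ)

lemma kobayashiDist_le (h : DiscChain Ω z w ℓ) : kobayashiDist Ω z w ≤ ℓ :=
  csInf_le ⟨0, fun _ h => h.nonneg⟩ h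

end DiscChain

lemma kobayashiDist_nonneg (Ω : Set (EuclideanSpace ℂ (Fin d))) (z w : EuclideanSpace ℂ (Fin d)) :
    0 ≤ kobayashiDist Ω z w :=
  Real.sInf_nonneg fun _ h => DiscChain.nonneg h

lemma kobayashiDist_self (hz : z ∈ Ω) : kobayashiDist Ω z z = 0 :=
  le_antisymm (DiscChain.nil z hz).kobayashiDist_le (kobayashiDist_nonneg ..)

lemma kobayashiDist_comm (Ω : Set (EuclideanSpace ℂ (Fin d))) (z w : EuclideanSpace ℂ (Fin d)) :
    kobayashiDist Ω z w = kobayashiDist Ω w z :=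
  congrArg sInf (Set.ext fun _ => ⟨DiscChain.symm, DiscChain.symm⟩)

lemma eventually_discChain (hΩ : Ω ∈ 𝓝 z) {t : ℝ} (ht : 0 < t) :
    ∀ᶠ w in 𝓝 z, DiscChain Ω z w t := by
  obtain ⟨ρ, hρ, hball⟩ := Metric.mem_nhds_iff.1 hΩ
  have htanh := tanh_pos ht
  filter_upwards [closedBall_mem_nhds z (mul_pos hρ htanh)] with w hw
  rw [mem_closedBall_iff_norm] at hw
  let f (a : ℂ) : EuclideanSpace ℂ (Fin d) := z + (a / Real.tanh t) • (w - z)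
  have hfΩ : Set.MapsTo f (ball 0 1) Ω := fun a ha => hball <| by
    calc dist (f a) z = ‖a‖ / Real.tanh t * ‖w - z‖ := by
          simp [f, norm_smul, -Complex.ofReal_tanh, abs_of_pos htanh]
      _ ≤ ‖a‖ / Real.tanh t * (ρ * Real.tanh t) := by gcongr
      _ = ‖a‖ * ρ := by field_simp
      _ < ρ := mul_lt_of_lt_one_left hρ (mem_ball_zero_iff.1 ha)
  have hf : DifferentiableOn ℂ f (ball 0 1) := by fun_prop
  have hft : f (Real.tanh t) = w := by
    simp only [f, div_self (Complex.ofReal_ne_zero.2 htanh.ne'), one_smul, add_sub_cancel]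
  have hlength : poincareDist (Real.tanh 0) (Real.tanh t) = t := by
    rw [poincareDist_tanh, zero_sub, abs_neg, abs_of_pos ht]
  rw [← hlength, ← show f (Real.tanh 0) = z by simp [f], ← hft]
  exact .single hf hfΩ (ofReal_tanh_mem_ball 0) (ofReal_tanh_mem_ball t)

lemma exists_discChain (hopen : IsOpen Ω) (hconn : IsPreconnected Ω) (hz : z ∈ Ω) (hw : w ∈ Ω) :
    ∃ ℓ, DiscChain Ω z w ℓ := by
  refine hconn.induction₂ (fun z w => ∃ ℓ, DiscChain Ω z w ℓ) (fun z hz => ?_) ?_ ?_ hz hw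
  · exact ((eventually_discChain (hopen.mem_nhds hz) one_pos).filter_mono
      nhdsWithin_le_nhds).mono fun _ h => ⟨1, h⟩
  · rintro _ _ _ - - - ⟨_, h⟩ ⟨_, h'⟩
    exact ⟨_, h.trans h'⟩
  · rintro _ _ - - ⟨_, h⟩
    exact ⟨_, h.symm⟩

lemma exists_discChain_lt (hopen : IsOpen Ω) (hconn : IsPreconnected Ω) (hz : z ∈ Ω) (hw : w ∈ Ω)
    {r : ℝ} (hr : kobayashiDist Ω z w < r) : ∃ ℓ < r, DiscChain Ω z w ℓ := by
  obtain ⟨ℓ, h, hlt⟩ := exists_lt_of_csInf_lt (exists_discChain hopen hconn hz hw) hr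
  exact ⟨ℓ, hlt, h⟩

lemma kobayashiDist_triangle (hopen : IsOpen Ω) (hconn : IsPreconnected Ω) (hz : z ∈ Ω)
    (hw : w ∈ Ω) (hp : p ∈ Ω) :
    kobayashiDist Ω z p ≤ kobayashiDist Ω z w + kobayashiDist Ω w p := by
  refine le_of_forall_pos_lt_add fun ε hε => ?_
  obtain ⟨ℓ, hℓ, h⟩ := exists_discChain_lt hopen hconn hz hw (lt_add_of_pos_right _ (half_pos hε))
  obtain ⟨ℓ', hℓ', h'⟩ :=
    exists_discChain_lt hopen hconn hw hp (lt_add_of_pos_right _ (half_pos hε))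
  linarith [(h.trans h').kobayashiDist_le]

lemma tendsto_kobayashiDist_nhds (hΩ : Ω ∈ 𝓝 z) :
    Tendsto (kobayashiDist Ω z) (𝓝 z) (𝓝 0) := by
  refine tendsto_order.2 ⟨fun r hr => .of_forall fun w => hr.trans_le (kobayashiDist_nonneg ..),
    fun r hr => ?_⟩
  exact (eventually_discChain hΩ (half_pos hr)).mono fun w h =>
    h.kobayashiDist_le.trans_lt (half_lt_self hr)

lemma continuousOn_kobayashiDist (hopen : IsOpen Ω) (hconn : IsPreconnected Ω) (hp : p ∈ Ω) :
    ContinuousOn (kobayashiDist Ω p) Ω := by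
  refine fun z hz => ContinuousAt.continuousWithinAt (tendsto_iff_dist_tendsto_zero.2 ?_)
  refine squeeze_zero' (.of_forall fun _ => dist_nonneg) ?_
    (tendsto_kobayashiDist_nhds (hopen.mem_nhds hz))
  filter_upwards [hopen.mem_nhds hz] with w hw
  rw [Real.dist_eq, abs_sub_le_iff]
  constructor
  · linarith [kobayashiDist_triangle hopen hconn hp hz hw]
  · linarith [kobayashiDist_triangle hopen hconn hp hw hz, kobayashiDist_comm Ω w z]

/-- A path in `Ω` that does not expand distances from `ℝ` to the Kobayashi pseudodistance. The
domain `ℝ` makes the paths of discs and their concatenations unrestricted functions; continuity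
refers to the Euclidean topology. -/
structure IsNonexpandingPath (Ω : Set (EuclideanSpace ℂ (Fin d)))
    (c : ℝ → EuclideanSpace ℂ (Fin d)) : Prop where
  continuous : Continuous c
  mem (t : ℝ) : c t ∈ Ω
  kobayashiDist_le (s t : ℝ) : kobayashiDist Ω (c s) (c t) ≤ |s - t|

namespace IsNonexpandingPath

lemma const (hz : z ∈ Ω) : IsNonexpandingPath Ω fun _ => z :=
  ⟨continuous_const, fun _ => hz, fun s t => (kobayashiDist_self hz).trans_le (abs_nonneg (s - t))⟩

lemma comp_tanh {f : ℂ → EuclideanSpace ℂ (Fin d)} (hf : DifferentiableOn ℂ f (ball 0 1))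
    (hfΩ : Set.MapsTo f (ball 0 1) Ω) : IsNonexpandingPath Ω fun t => f (Real.tanh t) where
  continuous := hf.continuousOn.comp_continuous
    (Complex.continuous_ofReal.comp continuous_tanh) ofReal_tanh_mem_ball
  mem t := hfΩ (ofReal_tanh_mem_ball t)
  kobayashiDist_le s t := poincareDist_tanh s t ▸
    (DiscChain.single hf hfΩ (ofReal_tanh_mem_ball s) (ofReal_tanh_mem_ball t)).kobayashiDist_le

lemma concat (hopen : IsOpen Ω) (hconn : IsPreconnected Ω) {c₁ c₂ : ℝ → EuclideanSpace ℂ (Fin d)}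
    {L : ℝ} (h₁ : IsNonexpandingPath Ω c₁) (h₂ : IsNonexpandingPath Ω c₂) (hL : c₁ L = c₂ 0) :
    IsNonexpandingPath Ω fun t => if t ≤ L then c₁ t else c₂ (t - L) where
  continuous := Continuous.if_le h₁.continuous (h₂.continuous.comp (continuous_sub_right L))
    continuous_id continuous_const fun t ht => by simp_all
  mem t := by
    split_ifs
    exacts [h₁.mem t, h₂.mem (t - L)]
  kobayashiDist_le s t := by
    wlog hst : s ≤ t generalizing s t
    · rw [kobayashiDist_comm, abs_sub_comm]
      exact this t s (le_of_not_ge hst)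
    split_ifs with hs ht ht
    · exact h₁.kobayashiDist_le s t
    · calc kobayashiDist Ω (c₁ s) (c₂ (t - L))
          ≤ kobayashiDist Ω (c₁ s) (c₁ L) + kobayashiDist Ω (c₁ L) (c₂ (t - L)) :=
            kobayashiDist_triangle hopen hconn (h₁.mem s) (h₁.mem L) (h₂.mem (t - L))
        _ ≤ |s - L| + |0 - (t - L)| :=
            add_le_add (h₁.kobayashiDist_le s L) (hL ▸ h₂.kobayashiDist_le 0 (t - L))
        _ = |s - t| := by
            rw [abs_of_nonpos (by linarith), abs_of_nonpos (by linarith),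
              abs_of_nonpos (by linarith)]
            ring
    · exact absurd (hst.trans ht) hs
    · simpa using h₂.kobayashiDist_le (s - L) (t - L)

end IsNonexpandingPath

lemma DiscChain.exists_isNonexpandingPath (hopen : IsOpen Ω) (hconn : IsPreconnected Ω)
    (h : DiscChain Ω z w ℓ) : ∃ c, IsNonexpandingPath Ω c ∧ c 0 = z ∧ c ℓ = w := by
  induction h with
  | nil z hz => exact ⟨_, .const hz, rfl, rfl⟩
  | cons _ _ _ ℓ f ζ ξ hf hfΩ hζ hξ hz hz' tail ih =>
    obtain ⟨c, hc, hc0, hcℓ⟩ := ih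
    obtain ⟨φ, hφ, hφm, hφ0, hφL⟩ := exists_disc_automorphism_tanh hζ hξ
    have hdisc := IsNonexpandingPath.comp_tanh (hf.comp hφ hφm) (hfΩ.comp hφm)
    have hjoin : (f ∘ φ) (Real.tanh (poincareDist ζ ξ)) = c 0 := by
      rw [Function.comp_apply, hφL, hz', hc0]
    refine ⟨_, hdisc.concat hopen hconn hc hjoin, ?_, ?_⟩
    · simp [-Complex.ofReal_tanh, -Real.tanh_zero, poincareDist_nonneg hζ hξ, hφ0, hz]
    · rcases tail.nonneg.eq_or_lt with rfl | hℓ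
      · simp [-Complex.ofReal_tanh, hφL, hz', ← hc0, hcℓ]
      · simp [hℓ.not_ge, hcℓ]

/-! ### Hyperbolic domains -/

lemma exists_mem_frontier_kobayashiDist_lt (hopen : IsOpen Ω) (hconn : IsPreconnected Ω)
    {N : Set (EuclideanSpace ℂ (Fin d))} (hz : z ∈ Ω) (hw : w ∈ Ω) (hzN : z ∈ N) (hwN : w ∉ N)
    {r : ℝ} (hr : kobayashiDist Ω z w < r) : ∃ p ∈ Ω ∩ frontier N, kobayashiDist Ω z p < r := by
  obtain ⟨ℓ, hℓ, hchain⟩ := exists_discChain_lt hopen hconn hz hw hr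
  obtain ⟨c, hc, rfl, rfl⟩ := hchain.exists_isNonexpandingPath hopen hconn
  obtain ⟨t, ht, htN⟩ :=
    exists_mem_Icc_mem_frontier hchain.nonneg hc.continuous.continuousOn hzN hwN
  refine ⟨c t, ⟨hc.mem t, htN⟩, (hc.kobayashiDist_le 0 t).trans_lt ?_⟩
  rw [zero_sub, abs_neg, abs_of_nonneg ht.1]
  exact ht.2.trans_lt hℓ

lemma IsHyperbolic.exists_forall_le_kobayashiDist (hΩ : IsHyperbolic Ω) (hopen : IsOpen Ω)
    (hconn : IsPreconnected Ω) {K : Set (EuclideanSpace ℂ (Fin d))} (hK : IsCompact K)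
    (hKΩ : K ⊆ Ω) (hz : z ∈ Ω) (hzK : z ∉ K) : ∃ δ > 0, ∀ w ∈ K, δ ≤ kobayashiDist Ω z w := by
  rcases K.eq_empty_or_nonempty with rfl | hne
  · exact ⟨1, one_pos, by simp⟩
  obtain ⟨m, hm, hmin⟩ :=
    hK.exists_isMinOn hne ((continuousOn_kobayashiDist hopen hconn hz).mono hKΩ)
  exact ⟨_, (kobayashiDist_nonneg Ω z m).lt_of_ne' fun h0 => hzK (hΩ z hz m (hKΩ hm) h0 ▸ hm),
    fun w hw => hmin hw⟩

/-- **Barth's theorem**: the metric `k_Ω` of a hyperbolic domain induces the Euclidean topology. -/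
theorem IsHyperbolic.exists_forall_kobayashiDist_lt_imp_mem (hΩ : IsHyperbolic Ω)
    (hopen : IsOpen Ω) (hconn : IsPreconnected Ω) (hz : z ∈ Ω)
    {N : Set (EuclideanSpace ℂ (Fin d))} (hN : N ∈ 𝓝 z) :
    ∃ δ > 0, ∀ w ∈ Ω, kobayashiDist Ω z w < δ → w ∈ N := by
  obtain ⟨K, hKz, hKN, hK⟩ := local_compact_nhds (inter_mem hN (hopen.mem_nhds hz))
  have hfr : frontier K ⊆ K := hK.isClosed.frontier_subset
  obtain ⟨δ, hδ, hmin⟩ := hΩ.exists_forall_le_kobayashiDist hopen hconn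
    (hK.of_isClosed_subset isClosed_frontier hfr) (fun w hw => (hKN (hfr hw)).2) hz
    fun hzK => hzK.2 (mem_interior_iff_mem_nhds.2 hKz)
  refine ⟨δ, hδ, fun w hw hlt => ?_⟩
  by_contra hwN
  obtain ⟨p, ⟨-, hp⟩, hpδ⟩ := exists_mem_frontier_kobayashiDist_lt hopen hconn hz hw
    (mem_of_mem_nhds hKz) (fun hwK => hwN (hKN hwK).1) hlt
  exact (hmin p hp).not_gt hpδ

/-- Hyperbolic domains of `ℂᵈ`, for which the Kobayashi pseudodistance is a metric. The empty set
is not excluded. -/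
structure IsHyperbolicDomain (Ω : Set (EuclideanSpace ℂ (Fin d))) : Prop where
  isOpen : IsOpen Ω
  isPreconnected : IsPreconnected Ω
  isHyperbolic : IsHyperbolic Ω

/-- The points of a hyperbolic domain as a metric space for the Kobayashi distance; the subtype
`Ω` would carry the Euclidean metric. -/
@[ext]
structure KobayashiSpace (hΩ : IsHyperbolicDomain Ω) where
  /-- The underlying point of `ℂᵈ`. -/
  val : EuclideanSpace ℂ (Fin d)
  mem : val ∈ Ω

namespace KobayashiSpace

variable {hΩ : IsHyperbolicDomain Ω}

noncomputable instance : MetricSpace (KobayashiSpace hΩ) where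
  dist p q := kobayashiDist Ω p.val q.val
  dist_self p := kobayashiDist_self p.mem
  dist_comm p q := kobayashiDist_comm Ω p.val q.val
  dist_triangle p q r := kobayashiDist_triangle hΩ.isOpen hΩ.isPreconnected p.mem q.mem r.mem
  eq_of_dist_eq_zero {p q} h := KobayashiSpace.ext (hΩ.isHyperbolic p.val p.mem q.val q.mem h)

lemma range_val : Set.range (val : KobayashiSpace hΩ → _) = Ω :=
  Set.Subset.antisymm (Set.range_subset_iff.2 mem) fun z hz => ⟨⟨z, hz⟩, rfl⟩

lemma continuous_val : Continuous (val : KobayashiSpace hΩ → _) := by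
  refine continuous_iff_continuousAt.2 fun p N hN => ?_
  obtain ⟨δ, hδ, hsub⟩ := hΩ.isHyperbolic.exists_forall_kobayashiDist_lt_imp_mem hΩ.isOpen
    hΩ.isPreconnected p.mem hN
  exact Metric.mem_nhds_iff.2 ⟨δ, hδ, fun q hq => hsub q.val q.mem (mem_ball'.1 hq)⟩

lemma isOpenMap_val : IsOpenMap (val : KobayashiSpace hΩ → _) := by
  refine .of_nhds_le fun p s hs => ?_
  obtain ⟨ε, hε, hball⟩ := Metric.mem_nhds_iff.1 (mem_map.1 hs)
  have hΩp := hΩ.isOpen.mem_nhds p.mem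
  filter_upwards [hΩp, (tendsto_kobayashiDist_nhds hΩp).eventually_lt_const hε] with w hw hlt
  exact hball (a := ⟨w, hw⟩) (mem_ball'.2 hlt)

lemma isOpenEmbedding_val : IsOpenEmbedding (val : KobayashiSpace hΩ → _) :=
  .of_continuous_injective_isOpenMap continuous_val (fun _ _ => KobayashiSpace.ext) isOpenMap_val

lemma isLengthSpace : IsLengthSpace (KobayashiSpace hΩ) := by
  intro p q r hr
  obtain ⟨ℓ, hℓ, hchain⟩ := exists_discChain_lt hΩ.isOpen hΩ.isPreconnected p.mem q.mem hr
  obtain ⟨c, hc, hc0, hcℓ⟩ := hchain.exists_isNonexpandingPath hΩ.isOpen hΩ.isPreconnected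
  exact ⟨ℓ, ⟨hchain.nonneg, hℓ⟩, fun t => ⟨c t, hc.mem t⟩,
    .mk_one hc.kobayashiDist_le, KobayashiSpace.ext hc0, KobayashiSpace.ext hcℓ⟩

lemma completeSpace (hcomplete : IsCompleteHyperbolic Ω) : CompleteSpace (KobayashiSpace hΩ) := by
  refine Metric.complete_of_cauchySeq_tendsto fun u hu => ?_
  obtain ⟨p, hp, hlim⟩ :=
    hcomplete.2 (fun n => (u n).val) (fun n => (u n).mem) (Metric.cauchySeq_iff.1 hu)
  exact ⟨⟨p, hp⟩, tendsto_iff_dist_tendsto_zero.2 hlim⟩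

lemma properSpace (hcomplete : IsCompleteHyperbolic Ω) : ProperSpace (KobayashiSpace hΩ) :=
  have := completeSpace (hΩ := hΩ) hcomplete
  have := (isOpenEmbedding_val (hΩ := hΩ)).locallyCompactSpace
  isLengthSpace.properSpace

lemma hasVisibility_val (hvis : HasGeodesicVisibility Ω) :
    HasVisibility (val : KobayashiSpace hΩ → _) := by
  intro x hx y hy hxy
  rw [range_val] at hx hy
  obtain ⟨U, hU, V, hV, -, K, hK, hKΩ, hmeet⟩ := hvis x hx y hy hxy
  refine ⟨U, hU, V, hV, val ⁻¹' K, ?_, fun γ a b hab hγ ha hb =>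
    hmeet (fun t => (γ t).val) a b hab ⟨fun t _ => (γ t).mem, hγ⟩ ha hb⟩
  rwa [isOpenEmbedding_val.isInducing.isCompact_iff,
    Set.image_preimage_eq_of_subset (hKΩ.trans range_val.ge)]

lemma bigHorosphere_eq (o : KobayashiSpace hΩ) (x : EuclideanSpace ℂ (Fin d)) (R : ℝ) :
    bigHorosphere Ω o.val x R =
      val '' horosphereAlong o (comap val (𝓝 x)) (1 / 2 * Real.log R) := by
  have hfilter : 𝓝[Ω] x = map (val : KobayashiSpace hΩ → _) (comap val (𝓝 x)) := by
    rw [map_comap, range_val, nhdsWithin]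
  ext z
  simp only [bigHorosphere, hfilter]
  exact ⟨fun ⟨hz, h⟩ => ⟨⟨z, hz⟩, h, rfl⟩, fun ⟨p, h, hp⟩ => hp ▸ ⟨p.mem, h⟩⟩

end KobayashiSpace

end Kobayashi

theorem proposition1p2 (d : ℕ) (Ω : Set (EuclideanSpace ℂ (Fin d)))
    (hopen : IsOpen Ω) (hconn : IsConnected Ω)
    (hcomplete : Kobayashi.IsCompleteHyperbolic Ω)
    (hvis : Kobayashi.HasGeodesicVisibility Ω)
    (o : EuclideanSpace ℂ (Fin d)) (ho : o ∈ Ω)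
    (x : EuclideanSpace ℂ (Fin d)) (hx : x ∈ frontier Ω)
    (R : ℝ) (hR : 0 < R) :
    closure (Kobayashi.bigHorosphere Ω o x R) ∩ frontier Ω = {x} := by
  have hΩ : Kobayashi.IsHyperbolicDomain Ω := ⟨hopen, hconn.isPreconnected, hcomplete.1⟩
  let o' : Kobayashi.KobayashiSpace hΩ := ⟨o, ho⟩
  have := Kobayashi.KobayashiSpace.properSpace (hΩ := hΩ) hcomplete
  have hrange := Kobayashi.KobayashiSpace.range_val (hΩ := hΩ)
  have hmain := closure_image_horosphereAlong_inter_frontier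
    Kobayashi.KobayashiSpace.isLengthSpace.isGeodesicSpace
    Kobayashi.KobayashiSpace.isOpenEmbedding_val
    (Kobayashi.KobayashiSpace.hasVisibility_val hvis) o' (hrange ▸ hx) (1 / 2 * Real.log R)
  rwa [← Kobayashi.KobayashiSpace.bigHorosphere_eq, hrange] at hmain
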